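/- For an integer $n\ge 1$ let $\|n\|$ be the complexity of $n$: the least number of $1$'s needed to write $n$ using only $1$, addition, multiplication and parentheses. Put $\|0\|=0$. For integers $b\ge 2$ and $0\le r<b$ let $D(b,r)$ be the least number such that $$\|r+bn\|\le \|n\|+D(b,r)\qquad\text{for all integers } n\ge 1 .$$ Let $C_{\mathrm{avg}}$ be the infimum of all real $C$ such that the set of natural numbers $n$ with $\|n\|\le C\log n$ has natural density $1$ (here $\log$ is the natural logarithm, and the set of such $C$ is non-empty and bounded below, so that $C_{\mathrm{avg}}$ is a real number). Proposition. For every integer $b\ge 2$, $$C_{\mathrm{avg}}\le \frac{1}{b\log b}\sum_{r=0}^{b-1} D(b,r).$$ In particular, $$C_{\mathrm{avg}}\le \frac{41\,747\,875}{2^{7}\,3^{8}\log(2^{9}3^{8})}=3.3080772123153688960\ldots\le 3.309 .$$ -/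

import Mathlib

/-- Expressions built from the constant `1` with `+` and `×` (parentheses are implicit in the
tree structure). -/
inductive OneExpr : Type
  | one : OneExpr
  | add : OneExpr → OneExpr → OneExpr
  | mul : OneExpr → OneExpr → OneExpr

/-- The natural number denoted by an expression. -/
def OneExpr.value : OneExpr → ℕ
  | .one => 1
  | .add e f => e.value + f.value
  | .mul e f => e.value * f.value

/-- The number of `1`'s written in an expression. -/
def OneExpr.ones : OneExpr → ℕ
  | .one => 1
  | .add e f => e.ones + f.ones
  | .mul e f => e.ones + f.ones

/-- The complexity `‖n‖`: the least number of `1`'s in an expression of value `n`. No expression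
has value `0`, so `complexity 0 = sInf ∅ = 0`, which is the usual convention `‖0‖ = 0`. -/
noncomputable def complexity (n : ℕ) : ℕ :=
  sInf {k : ℕ | ∃ e : OneExpr, e.value = n ∧ e.ones = k}

/-- The digit cost `D(b, r)`: the least number `D` such that `‖r + b n‖ ≤ ‖n‖ + D` for all
`n ≥ 1`. -/
noncomputable def digitCost (b r : ℕ) : ℕ :=
  sInf {D : ℕ | ∀ n : ℕ, 1 ≤ n → complexity (r + b * n) ≤ complexity n + D}

open Classical in
/-- The set `S` of natural numbers has natural density `1`. -/
def HasDensityOne (S : Set ℕ) : Prop :=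
  Filter.Tendsto
    (fun N : ℕ => (((Finset.Icc 1 N).filter (fun n => n ∈ S)).card : ℝ) / (N : ℝ))
    Filter.atTop (nhds 1)

/-- The set of all real `C` such that `‖n‖ ≤ C log n` for a set of natural numbers `n` of
density `1`. -/
def avgConstants : Set ℝ :=
  {C : ℝ | HasDensityOne {n : ℕ | (complexity n : ℝ) ≤ C * Real.log (n : ℝ)}}

/-- The constant `C_avg`. -/
noncomputable def Cavg : ℝ := sInf avgConstants

theorem OneExpr.value_pos (e : OneExpr) : 0 < e.value := by
  induction e with
  | one => exact Nat.one_pos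
  | add e f he hf => exact Nat.add_pos_left he _
  | mul e f he hf => exact Nat.mul_pos he hf

theorem exists_expr_eq {n : ℕ} (hn : 1 ≤ n) :
    ∃ e : OneExpr, e.value = n ∧ e.ones = complexity n := by
  have hne : {k : ℕ | ∃ e : OneExpr, e.value = n ∧ e.ones = k}.Nonempty := by
    induction n, hn using Nat.le_induction with
    | base => exact ⟨_, .one, rfl, rfl⟩
    | succ n _ ih =>
      obtain ⟨_, e, he, _⟩ := ih
      exact ⟨_, .add e .one, congrArg (· + 1) he, rfl⟩
  exact Nat.sInf_mem hne

theorem complexity_value_le (e : OneExpr) : complexity e.value ≤ e.ones :=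
  Nat.sInf_le ⟨e, rfl, rfl⟩

theorem complexity_zero : complexity 0 = 0 := by
  have h : {k : ℕ | ∃ e : OneExpr, e.value = 0 ∧ e.ones = k} = ∅ := by
    ext k
    simp only [Set.mem_ofPred_eq, Set.mem_empty_iff_false, iff_false, not_exists, not_and]
    intro e he
    exact absurd he e.value_pos.ne'
  rw [complexity, h, Nat.sInf_empty]

/-- The set of numbers whose least element `D(b, r)` is meant to be is not empty. -/
theorem digitCost_isLeast {b : ℕ} (hb : 1 ≤ b) (r : ℕ) :
    IsLeast {D : ℕ | ∀ n : ℕ, 1 ≤ n → complexity (r + b * n) ≤ complexity n + D}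
      (digitCost b r) := by
  have hne : {D : ℕ | ∀ n : ℕ, 1 ≤ n →
      complexity (r + b * n) ≤ complexity n + D}.Nonempty := by
    refine ⟨complexity b + complexity r, fun n hn => ?_⟩
    obtain ⟨e, rfl, he⟩ := exists_expr_eq hn
    obtain ⟨f, rfl, hf⟩ := exists_expr_eq hb
    rcases Nat.eq_zero_or_pos r with rfl | hr
    · have h := complexity_value_le (.mul f e)
      simp only [OneExpr.value, OneExpr.ones] at h
      rw [Nat.zero_add, complexity_zero]
      omega
    · obtain ⟨g, rfl, hg⟩ := exists_expr_eq hr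
      have h := complexity_value_le (.add g (.mul f e))
      simp only [OneExpr.value, OneExpr.ones] at h
      omega
  exact ⟨Nat.sInf_mem hne, fun D hD => Nat.sInf_le hD⟩

/-! Write `n = s + d * m` according to the residue of `n` modulo `M`, pay `c` ones and continue with
`m`. Heuristically the `d` possible residues of `m` are equally likely, so `C` is admissible once a
potential `h` satisfies `c - C log d + (mean of h over the lifts) < h` at every residue. To make
this rigorous, `exp (t * h)` with small `t > 0` is used as a weight: induction on `N` bounds the sum
of `exp (t * ‖n‖)` over `n ≤ N` by `K * N ^ (1 + t * C)` (`exists_sum_exp_complexity_le`), and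
Markov's inequality makes `‖n‖ > C' log n` rare for every `C' > C`.

In base `b` all residues are lifts, and a potential exists as soon as `C log b` exceeds the mean
digit cost. The explicit quotient is not obtained from digit costs in base `2 ^ 9 * 3 ^ 8`: an
algorithm modulo `24` that divides by `2` or `3` gives `3.308`, which is already smaller. -/

/-! ### Residue algorithms and exponential moments -/

/-- The residues `q` modulo `M` with `s + d * q ≡ r` modulo `M`. -/
def residueLifts (M s d r : ℕ) : Finset ℕ :=
  (Finset.range M).filter fun q => (s + d * q) % M = r

/-- A procedure which, depending on the residue `r` of `n` modulo `M`, writes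
`n = s r + d r * m` and passes to `m`, at a cost of `c r` ones. -/
structure ResidueAlgorithm (M : ℕ) where
  s : ℕ → ℕ
  d : ℕ → ℕ
  c : ℕ → ℕ
  pos : 0 < M
  two_le : ∀ r < M, 2 ≤ d r
  dvd : ∀ r < M, d r ∣ M
  modEq : ∀ r < M, r % d r = s r % d r
  complexity_le : ∀ r < M, ∀ n, 1 ≤ n → complexity (s r + d r * n) ≤ complexity n + c r
  card_lifts : ∀ r < M, (residueLifts M (s r) (d r) r).card = d r

/-- The exponential moment of the complexity over the `n ≤ N` in a residue class. -/
noncomputable def classMoment (M : ℕ) (t : ℝ) (r N : ℕ) : ℝ :=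
  ∑ n ∈ (Finset.Icc 1 N).filter (fun n => n % M = r), Real.exp (t * complexity n)

namespace ResidueAlgorithm

variable {M : ℕ} (A : ResidueAlgorithm M)

/-- The residues modulo `M` that can follow the residue `r`. -/
abbrev lifts (r : ℕ) : Finset ℕ := residueLifts M (A.s r) (A.d r) r

theorem exists_eq {r n : ℕ} (hr : r < M) (hn : n % M = r) (hle : A.s r + A.d r ≤ n) :
    ∃ m, 1 ≤ m ∧ n = A.s r + A.d r * m ∧ m % M ∈ A.lifts r := by
  have hd := A.two_le r hr
  have h1 : n ≡ A.s r [MOD A.d r] := by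
    have h2 : n ≡ r [MOD M] := by rw [Nat.ModEq, hn, Nat.mod_eq_of_lt hr]
    exact (h2.of_dvd (A.dvd r hr)).trans (A.modEq r hr)
  obtain ⟨m, hm⟩ := (Nat.modEq_iff_dvd' (by omega)).1 h1.symm
  have hnm : n = A.s r + A.d r * m := by omega
  refine ⟨m, ?_, hnm, ?_⟩
  · rcases Nat.eq_zero_or_pos m with rfl | h
    · simp only [mul_zero] at hnm
      omega
    · exact h
  · refine Finset.mem_filter.2 ⟨Finset.mem_range.2 (Nat.mod_lt _ A.pos), ?_⟩
    calc (A.s r + A.d r * (m % M)) % M = (A.s r + A.d r * m) % M :=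
          ((Nat.mod_modEq m M).mul_left _).add_left _
      _ = r := by rw [← hnm, hn]

/-- Each `n ≥ s + d` in the class reduces to some `m ≤ N / d` at cost `c`, and `n` determines a term
for `m` injectively; the finitely many smaller `n` form the constant term. -/
theorem classMoment_le {t : ℝ} (ht : 0 ≤ t) {r : ℕ} (hr : r < M) (N : ℕ) :
    classMoment M t r N ≤
      (∑ n ∈ Finset.range (A.s r + A.d r), Real.exp (t * complexity n)) +
        Real.exp (t * A.c r) * ∑ q ∈ A.lifts r, classMoment M t q (N / A.d r) := by
  have hd := A.two_le r hr
  set T := (Finset.Icc 1 (N / A.d r)).filter (fun m => m % M ∈ A.lifts r) with hT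
  have hsub : (Finset.Icc 1 N).filter (fun n => n % M = r) ⊆
      Finset.range (A.s r + A.d r) ∪ T.image (fun m => A.s r + A.d r * m) := by
    intro n hn
    simp only [Finset.mem_filter, Finset.mem_Icc] at hn
    rw [Finset.mem_union, Finset.mem_range, Finset.mem_image]
    rcases lt_or_ge n (A.s r + A.d r) with h | h
    · exact Or.inl h
    · obtain ⟨m, hm1, hm2, hm3⟩ := A.exists_eq hr hn.2 h
      refine Or.inr ⟨m, ?_, hm2.symm⟩
      rw [hT, Finset.mem_filter, Finset.mem_Icc]
      refine ⟨⟨hm1, ?_⟩, hm3⟩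
      rw [Nat.le_div_iff_mul_le (by omega), mul_comm]
      omega
  have hsum : ∑ q ∈ A.lifts r, classMoment M t q (N / A.d r) =
      ∑ m ∈ T, Real.exp (t * complexity m) := by
    rw [← Finset.sum_fiberwise_of_maps_to (s := T) (t := A.lifts r) (g := fun m => m % M)
      (fun m hm => (Finset.mem_filter.1 hm).2)]
    refine Finset.sum_congr rfl fun q hq => ?_
    rw [classMoment]
    refine Finset.sum_congr ?_ fun _ _ => rfl
    ext m
    simp only [hT, Finset.mem_filter]
    constructor
    · rintro ⟨h1, rfl⟩
      exact ⟨⟨h1, hq⟩, rfl⟩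
    · rintro ⟨⟨h1, -⟩, h2⟩
      exact ⟨h1, h2⟩
  rw [classMoment, hsum, Finset.mul_sum]
  refine (Finset.sum_le_sum_of_subset_of_nonneg hsub fun _ _ _ => (Real.exp_pos _).le).trans ?_
  refine (le_add_of_nonneg_right (Finset.sum_nonneg fun _ _ => (Real.exp_pos _).le)).trans
    (Finset.sum_union_inter.trans_le ?_)
  rw [Finset.sum_image fun a _ b _ hab => Nat.eq_of_mul_eq_mul_left (by omega)
    (Nat.add_left_cancel hab)]
  gcongr with m hm
  rw [← Real.exp_add]
  have hm1 : 1 ≤ m := (Finset.mem_Icc.1 (Finset.mem_filter.1 hm).1).1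
  have h : (complexity (A.s r + A.d r * m) : ℝ) ≤ complexity m + A.c r := by
    exact_mod_cast A.complexity_le r hr m hm1
  refine Real.exp_le_exp.2 ?_
  nlinarith

/-- If `h` is a potential for the constant `C`, then the exponential of `t * h` is one for the
exponential moments, when `t` is small. -/
theorem eventually_exp_lt {C : ℝ} {h : ℕ → ℝ} {r : ℕ} (hr : r < M)
    (hh : A.c r - C * Real.log (A.d r) + (∑ q ∈ A.lifts r, h q) / A.d r < h r) :
    ∀ᶠ t in nhdsWithin (0 : ℝ) (Set.Ioi 0),
      (Real.exp (t * A.c r) * ∑ q ∈ A.lifts r, Real.exp (t * h q)) *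
        ((A.d r : ℝ) ^ (1 + t * C))⁻¹ < Real.exp (t * h r) := by
  have hd : (0 : ℝ) < A.d r := by
    have := A.two_le r hr
    exact_mod_cast (by omega : 0 < A.d r)
  -- After division by `exp (t * h r)` the claim reads `∑ exp (t * u q) < d r`. Equality holds at `t
  -- = 0` because there are `d r` lifts, and the derivative there, `∑ u q`, is negative.
  set u : ℕ → ℝ := fun q => A.c r - C * Real.log (A.d r) + h q - h r with hu
  have hder : HasDerivAt (fun t : ℝ => ∑ q ∈ A.lifts r, Real.exp (t * u q))
      (∑ q ∈ A.lifts r, u q) 0 := by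
    refine HasDerivAt.fun_sum fun q _ => ?_
    simpa using ((hasDerivAt_id (0 : ℝ)).mul_const (u q)).exp
  have hneg : ∑ q ∈ A.lifts r, u q < 0 := by
    have h1 : ∑ q ∈ A.lifts r, u q = A.d r * (A.c r - C * Real.log (A.d r) +
        (∑ q ∈ A.lifts r, h q) / A.d r - h r) := by
      simp only [hu, Finset.sum_sub_distrib, Finset.sum_add_distrib, Finset.sum_const,
        A.card_lifts r hr, nsmul_eq_mul]
      field_simp
    rw [h1]
    exact mul_neg_of_pos_of_neg hd (by linarith)
  have hslope := (hasDerivAt_iff_tendsto_slope.1 hder).mono_left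
    (nhdsWithin_mono (0 : ℝ) fun x (hx : x ∈ Set.Ioi 0) => (ne_of_gt hx : x ≠ 0))
  filter_upwards [hslope.eventually (gt_mem_nhds hneg), self_mem_nhdsWithin] with t ht ht0
  have ht0 : 0 < t := ht0
  rw [slope_def_field, sub_zero, div_lt_iff₀ ht0, zero_mul, sub_lt_zero] at ht
  simp only [zero_mul, Real.exp_zero, Finset.sum_const, A.card_lifts r hr, nsmul_eq_mul,
    mul_one] at ht
  have hkey : (Real.exp (t * A.c r) * ∑ q ∈ A.lifts r, Real.exp (t * h q)) *
      ((A.d r : ℝ) ^ (1 + t * C))⁻¹ =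
      Real.exp (t * h r) * ((∑ q ∈ A.lifts r, Real.exp (t * u q)) * (A.d r : ℝ)⁻¹) := by
    rw [Real.rpow_add hd, Real.rpow_one, Real.rpow_def_of_pos hd, mul_inv, ← Real.exp_neg,
      Finset.mul_sum, Finset.sum_mul, Finset.sum_mul, Finset.mul_sum]
    refine Finset.sum_congr rfl fun q _ => ?_
    have h2 : Real.exp (t * A.c r) * Real.exp (t * h q) *
        Real.exp (-(Real.log (A.d r) * (t * C))) =
        Real.exp (t * h r) * Real.exp (t * u q) := by
      simp only [← Real.exp_add, hu]
      ring_nf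
    linear_combination (A.d r : ℝ)⁻¹ * h2
  rw [hkey]
  refine mul_lt_of_lt_one_right (Real.exp_pos _) ?_
  rw [← div_eq_mul_inv, div_lt_one hd]
  exact ht

theorem exists_sum_exp_complexity_le {C : ℝ} (hC : 0 ≤ C) {h : ℕ → ℝ}
    (hh : ∀ r < M, A.c r - C * Real.log (A.d r) + (∑ q ∈ A.lifts r, h q) / A.d r < h r) :
    ∃ t : ℝ, 0 < t ∧ ∃ K : ℝ, ∀ N : ℕ,
      ∑ n ∈ Finset.Icc 1 N, Real.exp (t * complexity n) ≤ K * (N : ℝ) ^ (1 + t * C) := by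
  have hev : ∀ᶠ t in nhdsWithin (0 : ℝ) (Set.Ioi 0), ∀ r ∈ Finset.range M,
      (Real.exp (t * A.c r) * ∑ q ∈ A.lifts r, Real.exp (t * h q)) *
        ((A.d r : ℝ) ^ (1 + t * C))⁻¹ < Real.exp (t * h r) :=
    (Filter.eventually_all_finset _).2 fun r hr =>
      A.eventually_exp_lt (Finset.mem_range.1 hr) (hh r (Finset.mem_range.1 hr))
  obtain ⟨t, ht, ht0⟩ := (hev.and self_mem_nhdsWithin).exists
  have ht0 : 0 < t := ht0
  set δ : ℕ → ℝ := fun r => Real.exp (t * h r) -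
    (Real.exp (t * A.c r) * ∑ q ∈ A.lifts r, Real.exp (t * h q)) *
      ((A.d r : ℝ) ^ (1 + t * C))⁻¹ with hδ
  set B : ℕ → ℝ := fun r => ∑ n ∈ Finset.range (A.s r + A.d r), Real.exp (t * complexity n)
    with hB
  have hδpos : ∀ r < M, 0 < δ r := fun r hr => sub_pos.2 (ht r (Finset.mem_range.2 hr))
  have hBnn : ∀ r, 0 ≤ B r := fun r => Finset.sum_nonneg fun _ _ => (Real.exp_pos _).le
  -- The strict slack `δ r` absorbs the boundary term `B r` once `K` is large.
  obtain ⟨K, hK0, hK⟩ : ∃ K : ℝ, 0 ≤ K ∧ ∀ r < M, B r ≤ K * δ r := by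
    have hnn : ∀ r ∈ Finset.range M, 0 ≤ B r / δ r := fun r hr =>
      div_nonneg (hBnn r) (hδpos r (Finset.mem_range.1 hr)).le
    refine ⟨∑ r ∈ Finset.range M, B r / δ r, Finset.sum_nonneg hnn, fun r hr => ?_⟩
    rw [← div_le_iff₀ (hδpos r hr)]
    exact Finset.single_le_sum hnn (Finset.mem_range.2 hr)
  have hα : 0 ≤ 1 + t * C := by positivity
  have hmain : ∀ N : ℕ, ∀ r < M,
      classMoment M t r N ≤ K * Real.exp (t * h r) * (N : ℝ) ^ (1 + t * C) := by
    intro N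
    induction N using Nat.strong_induction_on with
    | _ N ih =>
      intro r hr
      have hd := A.two_le r hr
      have hd' : (0 : ℝ) < A.d r := by exact_mod_cast (by omega : 0 < A.d r)
      rcases Nat.eq_zero_or_pos N with rfl | hN
      · simp only [classMoment, Finset.Icc_eq_empty_of_lt Nat.zero_lt_one, Finset.filter_empty,
          Finset.sum_empty]
        positivity
      · have hNα : 1 ≤ (N : ℝ) ^ (1 + t * C) :=
          Real.one_le_rpow (by exact_mod_cast hN) hα
        have hdiv : ((N / A.d r : ℕ) : ℝ) ^ (1 + t * C) ≤
            (N : ℝ) ^ (1 + t * C) * ((A.d r : ℝ) ^ (1 + t * C))⁻¹ := by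
          rw [← div_eq_mul_inv, ← Real.div_rpow (by positivity) hd'.le]
          exact Real.rpow_le_rpow (by positivity) Nat.cast_div_le hα
        have hstep : ∑ q ∈ A.lifts r, classMoment M t q (N / A.d r) ≤
            ∑ q ∈ A.lifts r, K * Real.exp (t * h q) *
              ((N : ℝ) ^ (1 + t * C) * ((A.d r : ℝ) ^ (1 + t * C))⁻¹) := by
          refine Finset.sum_le_sum fun q hq => ?_
          refine (ih _ (Nat.div_lt_self hN (by omega)) q
            (Finset.mem_range.1 (Finset.mem_filter.1 hq).1)).trans ?_
          gcongr
        calc classMoment M t r N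
            ≤ B r + Real.exp (t * A.c r) * ∑ q ∈ A.lifts r, K * Real.exp (t * h q) *
              ((N : ℝ) ^ (1 + t * C) * ((A.d r : ℝ) ^ (1 + t * C))⁻¹) :=
              (A.classMoment_le ht0.le hr N).trans (by gcongr)
          _ = B r + K * (N : ℝ) ^ (1 + t * C) * (Real.exp (t * h r) - δ r) := by
              rw [← Finset.sum_mul, ← Finset.mul_sum, hδ]
              ring
          _ ≤ K * δ r * (N : ℝ) ^ (1 + t * C) +
                K * (N : ℝ) ^ (1 + t * C) * (Real.exp (t * h r) - δ r) := by
              gcongr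
              exact (hK r hr).trans (le_mul_of_one_le_right
                (mul_nonneg hK0 (hδpos r hr).le) hNα)
          _ = K * Real.exp (t * h r) * (N : ℝ) ^ (1 + t * C) := by ring
  refine ⟨t, ht0, ∑ r ∈ Finset.range M, K * Real.exp (t * h r), fun N => ?_⟩
  rw [← Finset.sum_fiberwise_of_maps_to (s := Finset.Icc 1 N) (t := Finset.range M)
    (g := fun n => n % M) (fun n _ => Finset.mem_range.2 (Nat.mod_lt _ A.pos)), Finset.sum_mul]
  exact Finset.sum_le_sum fun r hr => hmain N r (Finset.mem_range.1 hr)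

end ResidueAlgorithm

/-! ### From exponential moments to density one -/

/-- Arbitrary finsets `T N` of exceptions keep decidability instances for `S` out of the hypothesis.
-/
theorem hasDensityOne_of_card_compl_le {S : Set ℕ} {f : ℕ → ℝ}
    (hf : Filter.Tendsto (fun N => f N / (N : ℝ)) Filter.atTop (nhds 0))
    (hS : ∀ (T : ℕ → Finset ℕ), (∀ N, ∀ n ∈ T N, n ∈ Finset.Icc 1 N ∧ n ∉ S) →
      ∀ᶠ N in Filter.atTop, ((T N).card : ℝ) ≤ f N) : HasDensityOne S := by
  classical
  unfold HasDensityOne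
  have hcard := hS (fun N => (Finset.Icc 1 N).filter (fun n => n ∉ S))
    fun N n hn => Finset.mem_filter.1 hn
  have hlow : Filter.Tendsto (fun N : ℕ => 1 - f N / (N : ℝ)) Filter.atTop (nhds 1) := by
    simpa using tendsto_const_nhds.sub hf
  refine tendsto_of_tendsto_of_tendsto_of_le_of_le' hlow tendsto_const_nhds ?_ ?_
  · filter_upwards [hcard, Filter.eventually_gt_atTop 0] with N hN hpos
    have hN0 : (0 : ℝ) < N := by exact_mod_cast hpos
    have hsplit := Finset.card_filter_add_card_filter_not (s := Finset.Icc 1 N) (fun n => n ∈ S)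
    rw [Nat.card_Icc, Nat.add_sub_cancel] at hsplit
    have hsplit' : (((Finset.Icc 1 N).filter (fun n => n ∈ S)).card : ℝ) +
        ((Finset.Icc 1 N).filter (fun n => n ∉ S)).card = N := by exact_mod_cast hsplit
    rw [one_sub_div hN0.ne']
    refine le_trans ?_ (le_of_eq (congrArg (fun k : ℕ => (k : ℝ) / (N : ℝ)) ?_))
      (b := (((Finset.Icc 1 N).filter (fun n => n ∈ S)).card : ℝ) / (N : ℝ))
    · gcongr
      linarith
    · congr!
  · filter_upwards [Filter.eventually_gt_atTop 0] with N hpos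
    have hN0 : (0 : ℝ) < N := by exact_mod_cast hpos
    rw [div_le_one hN0]
    have h := Finset.card_filter_le (Finset.Icc 1 N) (fun n => n ∈ S)
    rw [Nat.card_Icc, Nat.add_sub_cancel] at h
    have h' : (((Finset.Icc 1 N).filter (fun n => n ∈ S)).card : ℝ) ≤ N := by exact_mod_cast h
    convert h'

/-- Markov's inequality for the exponential moments of the complexity. -/
theorem mem_avgConstants_of_sum_exp_le {t K C C' : ℝ} (ht : 0 < t) (hC : 0 ≤ C) (hCC' : C < C')
    (hK : ∀ N : ℕ, ∑ n ∈ Finset.Icc 1 N, Real.exp (t * complexity n) ≤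
      K * (N : ℝ) ^ (1 + t * C)) : C' ∈ avgConstants := by
  have hC' : 0 < C' := hC.trans_lt hCC'
  -- `β * C'` is the midpoint of `C` and `C'`: since `β < 1`, the `n ≤ N ^ β` are negligible, and
  -- since `β * C' > C`, Markov's inequality gains a power of `N` on the rest.
  set β : ℝ := (C + C') / (2 * C') with hβ
  have hβ1 : β < 1 := by rw [hβ, div_lt_one (by positivity)]; linarith
  have hβC : β * C' = (C + C') / 2 := by rw [hβ]; field_simp
  have hexp : t * C - t * β * C' < 0 := by
    rw [mul_assoc, hβC, ← mul_sub]
    exact mul_neg_of_pos_of_neg ht (by linarith)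
  refine hasDensityOne_of_card_compl_le
    (f := fun N => (N : ℝ) ^ β + K * (N : ℝ) ^ (1 + (t * C - t * β * C'))) ?_ ?_
  · have hpow : ∀ a : ℝ, a < 0 →
        Filter.Tendsto (fun N : ℕ => (N : ℝ) ^ a) Filter.atTop (nhds 0) := fun a ha => by
      have h := (tendsto_rpow_neg_atTop (neg_pos.2 ha)).comp
        (tendsto_natCast_atTop_atTop (R := ℝ))
      rw [neg_neg] at h
      exact h
    have hlim := (hpow (β - 1) (by linarith)).add ((hpow _ hexp).const_mul K)
    rw [mul_zero, add_zero] at hlim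
    refine hlim.congr' ?_
    filter_upwards [Filter.eventually_gt_atTop 0] with N hpos
    have hN0 : (0 : ℝ) < N := by exact_mod_cast hpos
    rw [Real.rpow_sub hN0, Real.rpow_add hN0, Real.rpow_one]
    field_simp
  · intro T hT
    filter_upwards [Filter.eventually_gt_atTop 0] with N hpos
    have hN0 : (0 : ℝ) < N := by exact_mod_cast hpos
    have hw : ∀ n ∈ T N, (N : ℝ) ^ β < n →
        (N : ℝ) ^ (t * β * C') ≤ Real.exp (t * complexity n) := by
      intro n hn hlt
      have hnS := (hT N n hn).2
      simp only [Set.mem_ofPred_eq, not_le] at hnS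
      have hlog : β * Real.log N ≤ Real.log n := by
        rw [← Real.log_rpow hN0]
        exact Real.log_le_log (by positivity) hlt.le
      rw [Real.rpow_def_of_pos hN0]
      refine Real.exp_le_exp.2 ?_
      nlinarith [mul_le_mul_of_nonneg_left hlog (mul_pos ht hC').le,
        mul_le_mul_of_nonneg_left hnS.le ht.le]
    have hsmall : (((T N).filter (fun n : ℕ => (n : ℝ) ≤ (N : ℝ) ^ β)).card : ℝ) ≤
        (N : ℝ) ^ β := by
      have hsub : (T N).filter (fun n : ℕ => (n : ℝ) ≤ (N : ℝ) ^ β) ⊆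
          Finset.Icc 1 ⌊(N : ℝ) ^ β⌋₊ := fun n hn => by
        obtain ⟨h1, h2⟩ := Finset.mem_filter.1 hn
        exact Finset.mem_Icc.2 ⟨(Finset.mem_Icc.1 (hT N n h1).1).1, Nat.le_floor h2⟩
      have hc := Finset.card_le_card hsub
      rw [Nat.card_Icc, Nat.add_sub_cancel] at hc
      exact (Nat.cast_le.2 hc).trans (Nat.floor_le (by positivity))
    have hlarge : (((T N).filter (fun n : ℕ => ¬ (n : ℝ) ≤ (N : ℝ) ^ β)).card : ℝ) ≤
        K * (N : ℝ) ^ (1 + (t * C - t * β * C')) := by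
      have h1 : (((T N).filter (fun n : ℕ => ¬ (n : ℝ) ≤ (N : ℝ) ^ β)).card : ℝ) *
          (N : ℝ) ^ (t * β * C') ≤ K * (N : ℝ) ^ (1 + t * C) := by
        rw [← nsmul_eq_mul]
        refine (Finset.card_nsmul_le_sum _ (fun n : ℕ => Real.exp (t * complexity n)) _
          fun n hn => ?_).trans
          ((Finset.sum_le_sum_of_subset_of_nonneg ?_ fun _ _ _ => (Real.exp_pos _).le).trans
            (hK N))
        · obtain ⟨h2, h3⟩ := Finset.mem_filter.1 hn
          exact hw n h2 (not_le.1 h3)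
        · exact fun n hn => (hT N n (Finset.mem_filter.1 hn).1).1
      rw [← add_sub_assoc, Real.rpow_sub hN0, ← mul_div_assoc, le_div_iff₀ (by positivity)]
      exact h1
    have hsplit := Finset.card_filter_add_card_filter_not (s := T N)
      (fun n : ℕ => (n : ℝ) ≤ (N : ℝ) ^ β)
    rw [← hsplit, Nat.cast_add]
    exact add_le_add hsmall hlarge

theorem ResidueAlgorithm.mem_avgConstants {M : ℕ} (A : ResidueAlgorithm M) {C C' : ℝ}
    (hC : 0 ≤ C) (hCC' : C < C') {h : ℕ → ℝ}
    (hh : ∀ r < M, A.c r - C * Real.log (A.d r) + (∑ q ∈ A.lifts r, h q) / A.d r < h r) :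
    C' ∈ avgConstants := by
  obtain ⟨t, ht, K, hK⟩ := A.exists_sum_exp_complexity_le hC hh
  exact mem_avgConstants_of_sum_exp_le ht hC hCC' hK

/-! ### Digits in base `b`, and the infimum -/

/-- Splitting off one digit in base `b`. -/
noncomputable def baseAlgorithm (b : ℕ) (hb : 2 ≤ b) : ResidueAlgorithm b where
  s := fun r => r
  d := fun _ => b
  c := digitCost b
  pos := by omega
  two_le := fun _ _ => hb
  dvd := fun _ _ => dvd_rfl
  modEq := fun _ _ => rfl
  complexity_le := fun r _ => (digitCost_isLeast (by omega) r).1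
  card_lifts := fun r hr => by
    rw [residueLifts, Finset.filter_true_of_mem, Finset.card_range]
    intro q _
    rw [Nat.add_mul_mod_self_left, Nat.mod_eq_of_lt hr]

theorem mem_avgConstants_of_digitCost_lt {b : ℕ} (hb : 2 ≤ b) {C : ℝ}
    (hC : 1 / ((b : ℝ) * Real.log b) * ∑ r ∈ Finset.range b, (digitCost b r : ℝ) < C) :
    C ∈ avgConstants := by
  have hb1 : (1 : ℝ) < b := by exact_mod_cast hb
  have hlog : 0 < Real.log b := Real.log_pos hb1
  obtain ⟨C₀, h0, h1⟩ := exists_between hC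
  have hnn : 0 ≤ 1 / ((b : ℝ) * Real.log b) * ∑ r ∈ Finset.range b, (digitCost b r : ℝ) := by
    positivity
  -- With this `h` the required inequality reduces to the mean of `h` being negative, which is the
  -- choice of `C₀`.
  refine (baseAlgorithm b hb).mem_avgConstants (hnn.trans h0.le) h1
    (h := fun r => digitCost b r - C₀ * Real.log b) fun r hr => ?_
  have hlifts : (baseAlgorithm b hb).lifts r = Finset.range b := by
    refine Finset.filter_true_of_mem fun q _ => ?_
    change (r + b * q) % b = r
    rw [Nat.add_mul_mod_self_left, Nat.mod_eq_of_lt hr]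
  rw [hlifts]
  change (digitCost b r : ℝ) - C₀ * Real.log b +
    (∑ q ∈ Finset.range b, ((digitCost b q : ℝ) - C₀ * Real.log b)) / (b : ℝ) < _
  rw [add_lt_iff_neg_left, Finset.sum_sub_distrib, Finset.sum_const, Finset.card_range,
    nsmul_eq_mul]
  refine div_neg_of_neg_of_pos ?_ (by linarith)
  rw [one_div_mul_eq_div, div_lt_iff₀ (by positivity)] at h0
  linarith

/-- For `C < 0` the bound `C log n` is negative when `n > 1`, so only `n = 1` can qualify. -/
theorem zero_mem_lowerBounds_avgConstants : (0 : ℝ) ∈ lowerBounds avgConstants := by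
  intro C hC
  by_contra! hneg
  have hzero : Filter.Tendsto (fun N : ℕ => (1 : ℝ) / (N : ℝ)) Filter.atTop (nhds 0) :=
    tendsto_const_div_atTop_nhds_zero_nat 1
  refine absurd (le_of_tendsto_of_tendsto hC hzero (Filter.Eventually.of_forall fun N => ?_))
    (by norm_num)
  refine div_le_div_of_nonneg_right ?_ (Nat.cast_nonneg N)
  refine Nat.cast_le_one.2 (Finset.card_le_one.2 fun a ha b hb => ?_)
  have h1 : ∀ n : ℕ, 1 ≤ n → (complexity n : ℝ) ≤ C * Real.log n → n = 1 := fun n hn hle => by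
    by_contra hne
    have hlog : 0 < Real.log n := Real.log_pos (by exact_mod_cast (by omega : 1 < n))
    nlinarith [(Nat.cast_nonneg (complexity n) : (0 : ℝ) ≤ complexity n)]
  obtain ⟨ha1, ha2⟩ := Finset.mem_filter.1 ha
  obtain ⟨hb1, hb2⟩ := Finset.mem_filter.1 hb
  rw [h1 a (Finset.mem_Icc.1 ha1).1 ha2, h1 b (Finset.mem_Icc.1 hb1).1 hb2]

theorem isGLB_Cavg : IsGLB avgConstants Cavg :=
  isGLB_csInf ⟨_, mem_avgConstants_of_digitCost_lt le_rfl (lt_add_one _)⟩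
    ⟨0, zero_mem_lowerBounds_avgConstants⟩

/-! ### Division by `2` or `3` modulo `24` -/

theorem complexity_add_mul_le (s d : OneExpr) {n : ℕ} (hn : 1 ≤ n) :
    complexity (s.value + d.value * n) ≤ complexity n + (s.ones + d.ones) := by
  obtain ⟨e, rfl, he⟩ := exists_expr_eq hn
  have h := complexity_value_le (.add s (.mul d e))
  simp only [OneExpr.value, OneExpr.ones] at h
  omega

theorem complexity_mul_le (d : OneExpr) {n : ℕ} (hn : 1 ≤ n) :
    complexity (d.value * n) ≤ complexity n + d.ones := by
  obtain ⟨e, rfl, he⟩ := exists_expr_eq hn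
  have h := complexity_value_le (.mul d e)
  simp only [OneExpr.value, OneExpr.ones] at h
  omega

def OneExpr.two : OneExpr := .add .one .one

def OneExpr.three : OneExpr := .add .two .one

/-- For each residue modulo `24`, the number to subtract before dividing. -/
def subtrahend24 (r : ℕ) : ℕ :=
  [0, 1, 0, 0, 0, 1, 0, 1, 0, 0, 0, 1, 0, 1, 0, 0, 0, 1, 0, 1, 0, 0, 1, 2].getD r 0

/-- For each residue modulo `24`, the number to divide by. -/
def divisor24 (r : ℕ) : ℕ :=
  [3, 3, 2, 3, 2, 2, 3, 3, 2, 3, 2, 2, 3, 3, 2, 3, 2, 2, 3, 3, 2, 3, 3, 3].getD r 0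

/-- For each residue modulo `24`, one hundred times its potential. -/
def potential24 (r : ℕ) : ℕ :=
  [0, 100, 100, 84, 100, 200, 64, 164, 75, 125, 175, 275, 53, 153, 153, 108, 103, 203, 96, 196,
    184, 147, 247, 347].getD r 0

theorem step24_cases : ∀ r < 24,
    (divisor24 r = 2 ∧ subtrahend24 r ≤ 1 ∨ divisor24 r = 3 ∧ subtrahend24 r ≤ 2) := by
  decide

/-- Division by `2` or `3`, depending on the residue modulo `24`. -/
def algorithm24 : ResidueAlgorithm 24 where
  s := subtrahend24
  d := divisor24
  c := fun r => subtrahend24 r + divisor24 r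
  pos := by norm_num
  two_le := by decide
  dvd := by decide
  modEq := by decide
  complexity_le := fun r hr n hn => by
    have h20 := complexity_mul_le .two hn
    have h30 := complexity_mul_le .three hn
    have h21 := complexity_add_mul_le .one .two hn
    have h31 := complexity_add_mul_le .one .three hn
    have h32 := complexity_add_mul_le .two .three hn
    simp only [OneExpr.two, OneExpr.three, OneExpr.value, OneExpr.ones] at h20 h30 h21 h31 h32
    norm_num at h20 h30 h21 h31 h32
    rcases step24_cases r hr with ⟨hd, hs⟩ | ⟨hd, hs⟩ <;> rw [hd] <;>
      interval_cases subtrahend24 r <;> simpa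
  card_lifts := by decide

/-- The potential inequality times `100 * d`, in integers: `458 < 200 * 3.308 * log 2` and `1088 <
300 * 3.308 * log 3`. -/
theorem potential24_lt : ∀ r < 24,
    (divisor24 r = 2 ∧ 200 * subtrahend24 r + 400 + ∑ q ∈ algorithm24.lifts r, potential24 q + 1
        ≤ 2 * potential24 r + 458) ∨
    (divisor24 r = 3 ∧ 300 * subtrahend24 r + 900 + ∑ q ∈ algorithm24.lifts r, potential24 q + 1
        ≤ 3 * potential24 r + 1088) := by
  decide

theorem one_point_zero_nine_eight_lt_log_three : 1.098 < Real.log 3 := by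
  have h := Real.sum_range_le_log_div (x := 1 / 2) (by norm_num) (by norm_num) 6
  norm_num [Finset.sum_range_succ] at h
  linarith

theorem mem_avgConstants_of_gt {C : ℝ} (hC : 3.308 < C) : C ∈ avgConstants := by
  refine algorithm24.mem_avgConstants (by norm_num) hC (h := fun r => potential24 r / 100)
    fun r hr => ?_
  rw [← Finset.sum_div]
  change ((subtrahend24 r + divisor24 r : ℕ) : ℝ) - 3.308 * Real.log (divisor24 r : ℕ) +
    _ / ((divisor24 r : ℕ) : ℝ) < _
  have hlog2 := Real.log_two_gt_d9
  have hlog3 := one_point_zero_nine_eight_lt_log_three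
  rcases potential24_lt r hr with ⟨hd, h⟩ | ⟨hd, h⟩ <;>
  · have h' := (Nat.cast_le (α := ℝ)).2 h
    rw [hd]
    push_cast at h' ⊢
    linarith

theorem Cavg_le : Cavg ≤ 3.308 :=
  le_of_forall_gt_imp_ge_of_dense fun _ hC => isGLB_Cavg.1 (mem_avgConstants_of_gt hC)

/-! ### Numerical bounds and conclusion -/

/-- The series for `log ((1 + x) / (1 - x))` gives `log (3 / 2)` at `x = 1 / 5`, converging faster
than for `log 3` at `x = 1 / 2`. -/
theorem log_base_eq : Real.log (2 ^ 9 * 3 ^ 8) = 17 * Real.log 2 + 8 * Real.log (3 / 2) := by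
  rw [Real.log_mul (by norm_num) (by norm_num), Real.log_pow, Real.log_pow,
    Real.log_div (by norm_num) (by norm_num)]
  push_cast
  ring

theorem log_two_bounds :
    0.6931471805599453094172321 < Real.log 2 ∧ Real.log 2 < 0.6931471805599453094172322 := by
  have h₁ := Real.sum_range_le_log_div (x := 1 / 3) (by norm_num) (by norm_num) 28
  have h₂ := Real.log_div_le_sum_range_add (x := 1 / 3) (by norm_num) (by norm_num) 28
  norm_num [Finset.sum_range_succ] at h₁ h₂
  constructor <;> norm_num <;> linarith

theorem log_three_halves_bounds :
    0.4054651081081643819780131 < Real.log (3 / 2) ∧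
      Real.log (3 / 2) < 0.4054651081081643819780132 := by
  have h₁ := Real.sum_range_le_log_div (x := 1 / 5) (by norm_num) (by norm_num) 20
  have h₂ := Real.log_div_le_sum_range_add (x := 1 / 5) (by norm_num) (by norm_num) 20
  norm_num [Finset.sum_range_succ] at h₁ h₂
  constructor <;> norm_num <;> linarith

theorem mainTheorem3 :
    IsGLB avgConstants Cavg ∧
    (∀ b : ℕ, 2 ≤ b →
      Cavg ≤ 1 / ((b : ℝ) * Real.log (b : ℝ)) *
        ∑ r ∈ Finset.range b, (digitCost b r : ℝ)) ∧
    Cavg ≤ 41747875 / (2 ^ 7 * 3 ^ 8 * Real.log (2 ^ 9 * 3 ^ 8)) ∧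
    (3.3080772123153688960 : ℝ) ≤ 41747875 / (2 ^ 7 * 3 ^ 8 * Real.log (2 ^ 9 * 3 ^ 8)) ∧
    41747875 / (2 ^ 7 * 3 ^ 8 * Real.log (2 ^ 9 * 3 ^ 8)) < (3.3080772123153688961 : ℝ) ∧
    Cavg ≤ 3.309 := by
  obtain ⟨h2l, h2u⟩ := log_two_bounds
  obtain ⟨h3l, h3u⟩ := log_three_halves_bounds
  have hlow : (3.3080772123153688960 : ℝ) ≤
      41747875 / (2 ^ 7 * 3 ^ 8 * Real.log (2 ^ 9 * 3 ^ 8)) := by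
    rw [log_base_eq, le_div_iff₀ (by linarith)]
    linarith
  have hupp : 41747875 / (2 ^ 7 * 3 ^ 8 * Real.log (2 ^ 9 * 3 ^ 8)) <
      (3.3080772123153688961 : ℝ) := by
    rw [log_base_eq, div_lt_iff₀ (by linarith)]
    linarith
  refine ⟨isGLB_Cavg, fun b hb => ?_, ?_, hlow, hupp, ?_⟩
  · exact le_of_forall_gt_imp_ge_of_dense fun C hC =>
      isGLB_Cavg.1 (mem_avgConstants_of_digitCost_lt hb hC)
  · exact (Cavg_le.trans (by norm_num)).trans hlow
  · exact Cavg_le.trans (by norm_num)
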